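/- Let $d \ge 1$ and let $p(z,x_1,\dots,x_n) = c_d(x)\,z^d + c_{d-1}(x)\,z^{d-1} + \dots + c_0(x)$, with $c_0,\dots,c_d \in \mathbb{R}[x_1,\dots,x_n]$ and $c_d \neq 0$, be a polynomial of degree $d$ in $z$. For $i \ge 1$ let $p^{(i)}$ denote the $i$-th derivative of $p$ with respect to $z$, and let $\operatorname{res}_z(p,p^{(i)}) \in \mathbb{R}[x_1,\dots,x_n]$ be the resultant with respect to $z$, i.e. the determinant of the Sylvester matrix of $p$ and $p^{(i)}$ regarded as polynomials in $z$ of degrees $d$ and $d-i$. Define $$A = \{ a \in \mathbb{R}^n : \operatorname{res}_z(p,p^{(i)})(a) \neq 0 \text{ for all } i = 1,\dots,d \}.$$ Then $A$ is an open subset of $\mathbb{R}^n$, and for each connected component $C$ of $A$ there are an integer $k \ge 0$ and functions $r_1,\dots,r_k : C \to \mathbb{R}$ such that: 1. $r_1,\dots,r_k$ are continuous on $C$, and for each $a \in C$ we have $r_1(a) < \dots < r_k(a)$ and the set of real roots of $p(z,a)$ in $z$ is $\{r_1(a),\dots,r_k(a)\}$. 2. For all $i = 1,\dots,d$ and $j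 = 1,\dots,k$, the sign $\sigma_{i,j} := \operatorname{sign}\big(p^{(i)}(r_j(a),a)\big)$ is nonzero and does not depend on $a \in C$. 3. For all $j = 1,\dots,k$, $a \in C$ and $z \in \mathbb{R}$: $z = r_j(a)$ if and only if $p(z,a) = 0$ and $\operatorname{sign}\big(p^{(i)}(z,a)\big) = \sigma_{i,j}$ for all $i = 1,\dots,d$. -/

import Mathlib

open Polynomial

noncomputable section

/-- The value at `z ∈ ℝ`, `a ∈ ℝⁿ` of a polynomial in the main variable `z` whose coefficients
are real polynomials in `x₁, …, xₙ`. -/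
def evalAt {n : ℕ} (p : (MvPolynomial (Fin n) ℝ)[X]) (z : ℝ) (a : Fin n → ℝ) : ℝ :=
  (p.map (MvPolynomial.eval a)).eval z

/-- The `i`-th derivative of `p` with respect to the main variable `z`. -/
def zDeriv {n : ℕ} (p : (MvPolynomial (Fin n) ℝ)[X]) (i : ℕ) : (MvPolynomial (Fin n) ℝ)[X] :=
  Polynomial.derivative^[i] p

/-- The set of `a ∈ ℝⁿ` at which none of the polynomials `res_z (p, p⁽ⁱ⁾)`, `1 ≤ i ≤ deg_z p`,
vanishes. The resultant is the determinant of the Sylvester matrix formed over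
`ℝ[x₁, …, xₙ]`, for the degrees of `p` and `p⁽ⁱ⁾` in `z`; it is then evaluated at `a`. -/
def regularSet {n : ℕ} (p : (MvPolynomial (Fin n) ℝ)[X]) : Set (Fin n → ℝ) :=
  {a | ∀ i : ℕ, 1 ≤ i → i ≤ p.natDegree →
    MvPolynomial.eval a (Polynomial.resultant p (zDeriv p i)) ≠ 0}

end

/-! ### Thom's lemma -/

/-! By Thom's lemma a root at which no derivative vanishes is determined by the signs of the
derivatives; over the regular set every root is of this kind. Hence it suffices to follow sign
vectors. For a fixed vector, the parameters having a root with these signs form an open set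
(`IsRootWithSigns.eventually_exists`: simple roots persist) that is closed in the regular set
(`exists_isRootWithSigns_of_mem_closure`: roots stay bounded as the leading coefficient does not
vanish, and signs survive in the limit). So the same vectors occur all over a component, and each
defines one continuous root function. -/

/-- If all derivatives of `f` have the same nonzero signs at `x` and at `y`, then the sign of `f`
is constant on `[x, y]`. -/
theorem sign_eval_eq_of_sign_iterate_derivative_eq {m : ℕ} {f : ℝ[X]} (hm : f.natDegree ≤ m)
    {x y : ℝ}
    (h0 : ∀ i ≤ m, (derivative^[i] f).eval x ≠ 0)
    (hs : ∀ i ≤ m, SignType.sign ((derivative^[i] f).eval x) =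
      SignType.sign ((derivative^[i] f).eval y)) :
    ∀ z ∈ Set.Icc x y, SignType.sign (f.eval z) = SignType.sign (f.eval x) := by
  induction m generalizing f with
  | zero =>
    intro z _
    rw [eq_C_of_natDegree_le_zero hm, eval_C, eval_C]
  | succ m ih =>
    intro z hz
    have hd : (derivative f).natDegree ≤ m := (natDegree_derivative_le f).trans (by omega)
    -- By induction `derivative f` has constant sign on `[x, y]`, so `f` is monotone there and
    -- `f.eval z` lies between two values of equal sign.
    have key := ih hd (fun i hi => h0 (i + 1) (by omega)) (fun i hi => hs (i + 1) (by omega))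
    have hfx : f.eval x ≠ 0 := h0 0 (by omega)
    have hfs : SignType.sign (f.eval x) = SignType.sign (f.eval y) := hs 0 (by omega)
    have hf'x : (derivative f).eval x ≠ 0 := h0 1 (by omega)
    have hxy : x ≤ y := hz.1.trans hz.2
    have hint : ∀ t ∈ interior (Set.Icc x y), t ∈ Set.Icc x y := fun t ht => interior_subset ht
    have hbetween : (f.eval x ≤ f.eval z ∧ f.eval z ≤ f.eval y) ∨
        (f.eval y ≤ f.eval z ∧ f.eval z ≤ f.eval x) := by
      rcases hf'x.lt_or_gt with hneg | hpos
      · right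
        have hanti : AntitoneOn (fun t => f.eval t) (Set.Icc x y) := by
          refine antitoneOn_of_deriv_nonpos (convex_Icc x y) f.continuous.continuousOn
            f.differentiable.differentiableOn fun t ht => ?_
          have := key t (hint t ht)
          rw [sign_neg hneg, sign_eq_neg_one_iff] at this
          rw [Polynomial.deriv]
          exact this.le
        exact ⟨hanti hz (Set.right_mem_Icc.2 hxy) hz.2, hanti (Set.left_mem_Icc.2 hxy) hz hz.1⟩
      · left
        have hmono : MonotoneOn (fun t => f.eval t) (Set.Icc x y) := by
          refine monotoneOn_of_deriv_nonneg (convex_Icc x y) f.continuous.continuousOn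
            f.differentiable.differentiableOn fun t ht => ?_
          have := key t (hint t ht)
          rw [sign_pos hpos, sign_eq_one_iff] at this
          rw [Polynomial.deriv]
          exact this.le
        exact ⟨hmono (Set.left_mem_Icc.2 hxy) hz hz.1, hmono hz (Set.right_mem_Icc.2 hxy) hz.2⟩
    rcases hfx.lt_or_gt with hneg | hpos
    · rw [sign_neg hneg] at hfs ⊢
      have hy := sign_eq_neg_one_iff.1 hfs.symm
      refine sign_neg ?_
      rcases hbetween with h | h <;> linarith [h.1, h.2]
    · rw [sign_pos hpos] at hfs ⊢
      have hy := sign_eq_one_iff.1 hfs.symm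
      refine sign_pos ?_
      rcases hbetween with h | h <;> linarith [h.1, h.2]

/-- Two roots of `f` at which all derivatives of `f` have the same nonzero signs are not in
strict order. -/
theorem not_lt_of_sign_iterate_derivative_eq {d : ℕ} (hd1 : 1 ≤ d) {f : ℝ[X]}
    (hd : f.natDegree ≤ d) {x y : ℝ} (hx : f.eval x = 0) (hy : f.eval y = 0)
    (h0 : ∀ i, 1 ≤ i → i ≤ d → (derivative^[i] f).eval x ≠ 0)
    (hs : ∀ i, 1 ≤ i → i ≤ d → SignType.sign ((derivative^[i] f).eval x) =
      SignType.sign ((derivative^[i] f).eval y)) : ¬ x < y := by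
  intro hxy
  obtain ⟨m, rfl⟩ : ∃ m, d = m + 1 := ⟨d - 1, by omega⟩
  -- Rolle's zero of the derivative contradicts its constant nonzero sign on `[x, y]`.
  obtain ⟨c, hc, hc0⟩ := exists_deriv_eq_zero hxy f.continuous.continuousOn (hx.trans hy.symm)
  rw [Polynomial.deriv] at hc0
  have key := sign_eval_eq_of_sign_iterate_derivative_eq (f := derivative f) (m := m)
    ((natDegree_derivative_le f).trans (by omega))
    (fun i hi => h0 (i + 1) (by omega) (by omega)) (fun i hi => hs (i + 1) (by omega) (by omega))
    c (Set.Ioo_subset_Icc_self hc)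
  rw [hc0, sign_zero] at key
  exact h0 1 le_rfl hd1 (sign_eq_zero_iff.1 key.symm)

/-- **Thom's lemma** for roots: a root of `f` is determined by the signs of the derivatives. -/
theorem root_unique_of_sign_iterate_derivative_eq {d : ℕ} (hd1 : 1 ≤ d) {f : ℝ[X]}
    (hd : f.natDegree ≤ d) {x y : ℝ} (hx : f.eval x = 0) (hy : f.eval y = 0)
    (h0 : ∀ i, 1 ≤ i → i ≤ d → (derivative^[i] f).eval x ≠ 0)
    (hs : ∀ i, 1 ≤ i → i ≤ d → SignType.sign ((derivative^[i] f).eval x) =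
      SignType.sign ((derivative^[i] f).eval y)) : x = y := by
  refine le_antisymm (not_lt.1 ?_) (not_lt.1 ?_)
  · refine not_lt_of_sign_iterate_derivative_eq hd1 hd hy hx (fun i h1 h2 h => ?_)
      fun i h1 h2 => (hs i h1 h2).symm
    have := hs i h1 h2
    rw [h, sign_zero] at this
    exact h0 i h1 h2 (sign_eq_zero_iff.1 this)
  · exact not_lt_of_sign_iterate_derivative_eq hd1 hd hx hy h0 hs

/-- A real polynomial with a simple root at `z` changes sign at `z`. -/
theorem exists_eval_mul_eval_neg {f : ℝ[X]} {z : ℝ} (hz : f.eval z = 0)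
    (hz' : (derivative f).eval z ≠ 0) {ε : ℝ} (hε : 0 < ε) :
    ∃ u v, z - ε < u ∧ u < v ∧ v < z + ε ∧ f.eval u * f.eval v < 0 := by
  -- With `f = (X - z) * g`, simplicity of the root means `g.eval z ≠ 0`, so `g` keeps its sign near
  -- `z` while `X - z` changes it.
  obtain ⟨g, hg⟩ := dvd_iff_isRoot.2 (show f.IsRoot z from hz)
  have hgz : g.eval z ≠ 0 := by
    intro h
    apply hz'
    rw [hg]
    simp [h]
  have hev : ∀ᶠ t in nhds z, g.eval t * g.eval z > 0 :=
    (g.continuous.mul continuous_const).continuousAt.eventually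
      (lt_mem_nhds (mul_self_pos.2 hgz))
  obtain ⟨δ, hδ, hball⟩ := Metric.eventually_nhds_iff.1 hev
  set η := min ε δ / 2 with hη
  have hη0 : 0 < η := by positivity
  have hηε : η < ε := by have := min_le_left ε δ; linarith
  have hηδ : η < δ := by have := min_le_right ε δ; linarith
  have h1 := @hball (z - η) (by rw [Real.dist_eq]; simp [abs_of_pos hη0, hηδ])
  have h2 := @hball (z + η) (by rw [Real.dist_eq]; simp [abs_of_pos hη0, hηδ])
  refine ⟨z - η, z + η, by linarith, by linarith, by linarith, ?_⟩
  have hgg : 0 < g.eval (z - η) * g.eval (z + η) := by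
    have h3 := mul_pos h1 h2
    have h4 : 0 < g.eval z * g.eval z := mul_self_pos.2 hgz
    by_contra hcon
    nlinarith
  have e : f.eval (z - η) * f.eval (z + η) = -(η * η * (g.eval (z - η) * g.eval (z + η))) := by
    rw [hg]; simp only [eval_mul, eval_sub, eval_X, eval_C]; ring
  rw [e]
  have := mul_pos (mul_pos hη0 hη0) hgg
  linarith

/-! ### Families of polynomials -/

section Family

variable {n : ℕ} (p : (MvPolynomial (Fin n) ℝ)[X])

theorem evalAt_eq_sum (z : ℝ) (a : Fin n → ℝ) :
    evalAt p z a =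
      ∑ i ∈ Finset.range (p.natDegree + 1), MvPolynomial.eval a (p.coeff i) * z ^ i := by
  rw [evalAt, eval_map, eval₂_eq_sum_range]

theorem continuous_evalAt : Continuous fun x : ℝ × (Fin n → ℝ) => evalAt p x.1 x.2 := by
  simp only [evalAt_eq_sum]
  refine continuous_finsetSum _ fun i _ => ?_
  exact ((MvPolynomial.continuous_eval _).comp continuous_snd).mul (continuous_fst.pow i)

theorem evalAt_zDeriv (i : ℕ) (z : ℝ) (a : Fin n → ℝ) :
    evalAt (zDeriv p i) z a =
      (derivative^[i] (p.map (MvPolynomial.eval a))).eval z := by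
  rw [evalAt, zDeriv, iterate_derivative_map]

theorem isOpen_regularSet : IsOpen (regularSet p) := by
  have : regularSet p = ⋂ i ∈ Finset.Icc 1 p.natDegree,
      {a | MvPolynomial.eval a (resultant p (zDeriv p i)) ≠ 0} := by
    ext a
    simp [regularSet]
  rw [this]
  exact isOpen_biInter_finset fun i _ =>
    isOpen_ne_fun (MvPolynomial.continuous_eval _) continuous_const

variable {p}

/-- The polynomials of the family over the regular set have no root in common with their
derivatives. -/
theorem evalAt_zDeriv_ne_zero {a : Fin n → ℝ} (ha : a ∈ regularSet p) {z : ℝ}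
    (hz : evalAt p z a = 0) {i : ℕ} (h1 : 1 ≤ i) (hi : i ≤ p.natDegree) :
    evalAt (zDeriv p i) z a ≠ 0 := by
  intro h
  -- The resultant is a combination of `p` and `zDeriv p i`, so it vanishes at `a` if they share a
  -- root there.
  obtain ⟨u, v, -, -, huv⟩ := exists_mul_add_mul_eq_C_resultant p (zDeriv p i)
    le_rfl le_rfl (Or.inl (by omega))
  apply ha i h1 hi
  have := congrArg (fun q => evalAt q z a) huv
  simp only [evalAt, Polynomial.map_add, Polynomial.map_mul, eval_add, eval_mul, map_C,
    eval_C] at this hz h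
  rw [← this, hz, h]
  ring

/-- The leading coefficient does not vanish on the regular set. -/
theorem eval_leadingCoeff_ne_zero (hd1 : 1 ≤ p.natDegree) {a : Fin n → ℝ}
    (ha : a ∈ regularSet p) : MvPolynomial.eval a (p.coeff p.natDegree) ≠ 0 := by
  intro h
  -- For `i = d` the derivative is the constant `d! * c_d`, and the resultant is its `d`-th power.
  apply ha p.natDegree hd1 le_rfl
  have hdeg : (zDeriv p p.natDegree).natDegree = 0 := by
    have := natDegree_iterate_derivative p p.natDegree
    rw [zDeriv]; omega
  rw [hdeg, resultant_zero_right_deg, zDeriv, coeff_iterate_derivative]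
  rw [coeff_natDegree] at h
  simp [h, show p.natDegree ≠ 0 by omega]

/-- A bound for the roots of the members of the family. -/
theorem abs_le_of_evalAt_eq_zero {a : Fin n → ℝ}
    (hlc : MvPolynomial.eval a (p.coeff p.natDegree) ≠ 0) {z : ℝ} (hz : evalAt p z a = 0) :
    |z| ≤ 1 + (∑ i ∈ Finset.range p.natDegree, |MvPolynomial.eval a (p.coeff i)|) /
      |MvPolynomial.eval a (p.coeff p.natDegree)| := by
  set S := ∑ i ∈ Finset.range p.natDegree, |MvPolynomial.eval a (p.coeff i)| with hS
  have hS0 : 0 ≤ S := Finset.sum_nonneg fun i _ => abs_nonneg _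
  have hc : 0 < |MvPolynomial.eval a (p.coeff p.natDegree)| := abs_pos.2 hlc
  by_cases h1 : |z| ≤ 1
  · have : 0 ≤ S / |MvPolynomial.eval a (p.coeff p.natDegree)| := by positivity
    linarith
  push Not at h1
  rw [evalAt_eq_sum, Finset.sum_range_succ] at hz
  -- The extra factor `|z|` avoids the exponent `d - 1`: for `i < d` and `|z| > 1`, `|z| ^ (i + 1) ≤
  -- |z| ^ d`.
  have hle : |MvPolynomial.eval a (p.coeff p.natDegree)| * |z| ^ p.natDegree * |z| ≤
      S * |z| ^ p.natDegree := by
    rw [← abs_pow, ← abs_mul, ← neg_eq_of_add_eq_zero_right hz, abs_neg, abs_pow, hS,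
      Finset.sum_mul]
    refine (mul_le_mul_of_nonneg_right (Finset.abs_sum_le_sum_abs _ _) (abs_nonneg z)).trans ?_
    rw [Finset.sum_mul]
    refine Finset.sum_le_sum fun i hi => ?_
    rw [abs_mul, abs_pow, mul_assoc, ← pow_succ]
    have := Finset.mem_range.1 hi
    gcongr
    · exact h1.le
    · omega
  have hzd : 0 < |z| ^ p.natDegree := by positivity
  have h2 : |z| * |MvPolynomial.eval a (p.coeff p.natDegree)| ≤ S := by
    refine le_of_mul_le_mul_right ?_ hzd
    linarith
  have := (le_div_iff₀ hc).2 h2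
  linarith

/-! ### Roots with prescribed derivative signs -/

variable (p) in
/-- `z` is a root of the member of the family at `a` whose derivatives have the signs `s`. -/
def IsRootWithSigns (s : ℕ → SignType) (z : ℝ) (a : Fin n → ℝ) : Prop :=
  evalAt p z a = 0 ∧ ∀ i, 1 ≤ i → i ≤ p.natDegree →
    SignType.sign (evalAt (zDeriv p i) z a) = s i

theorem IsRootWithSigns.unique (hd1 : 1 ≤ p.natDegree) {a : Fin n → ℝ} (ha : a ∈ regularSet p)
    {s : ℕ → SignType} {x y : ℝ} (hx : IsRootWithSigns p s x a) (hy : IsRootWithSigns p s y a) :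
    x = y := by
  refine root_unique_of_sign_iterate_derivative_eq hd1
    (f := p.map (MvPolynomial.eval a)) natDegree_map_le hx.1 hy.1 (fun i h1 hi => ?_)
    fun i h1 hi => ?_
  · rw [← evalAt_zDeriv]
    exact evalAt_zDeriv_ne_zero ha hx.1 h1 hi
  · rw [← evalAt_zDeriv, ← evalAt_zDeriv, hx.2 i h1 hi, hy.2 i h1 hi]

/-- The signs of the derivatives are locally constant near a root over the regular set. -/
theorem eventually_sign_evalAt_zDeriv_eq {a : Fin n → ℝ} (ha : a ∈ regularSet p) {z : ℝ}
    (hz : evalAt p z a = 0) :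
    ∀ᶠ x : ℝ × (Fin n → ℝ) in nhds (z, a), ∀ i, 1 ≤ i → i ≤ p.natDegree →
      SignType.sign (evalAt (zDeriv p i) x.1 x.2) =
        SignType.sign (evalAt (zDeriv p i) z a) := by
  have h : ∀ i ∈ Finset.Icc 1 p.natDegree, ∀ᶠ x : ℝ × (Fin n → ℝ) in nhds (z, a),
      SignType.sign (evalAt (zDeriv p i) x.1 x.2) =
        SignType.sign (evalAt (zDeriv p i) z a) := by
    intro i hi
    have hi' := Finset.mem_Icc.1 hi
    have hcont : ContinuousAt (fun x : ℝ × (Fin n → ℝ) => evalAt (zDeriv p i) x.1 x.2) (z, a) :=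
      (continuous_evalAt _).continuousAt
    rcases (evalAt_zDeriv_ne_zero ha hz hi'.1 hi'.2).lt_or_gt with hneg | hpos
    · filter_upwards [hcont.eventually (gt_mem_nhds hneg)] with x hx
      rw [sign_neg hneg, sign_neg hx]
    · filter_upwards [hcont.eventually (lt_mem_nhds hpos)] with x hx
      rw [sign_pos hpos, sign_pos hx]
  filter_upwards [(Filter.eventually_all_finset _).2 h] with x hx i h1 hi
  exact hx i (Finset.mem_Icc.2 ⟨h1, hi⟩)

/-- Roots over the regular set persist, together with the signs of the derivatives. -/
theorem IsRootWithSigns.eventually_exists (hd1 : 1 ≤ p.natDegree) {a : Fin n → ℝ}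
    (ha : a ∈ regularSet p) {s : ℕ → SignType} {z : ℝ} (hz : IsRootWithSigns p s z a)
    {ε : ℝ} (hε : 0 < ε) :
    ∀ᶠ b in nhds a, ∃ w, |w - z| < ε ∧ IsRootWithSigns p s w b := by
  have hsign := eventually_sign_evalAt_zDeriv_eq ha hz.1
  rw [nhds_prod_eq] at hsign
  obtain ⟨P, hP, Q, hQ, hPQ⟩ := Filter.eventually_prod_iff.1 hsign
  obtain ⟨δ, hδ, hball⟩ := Metric.eventually_nhds_iff.1 hP
  have hz' : (derivative (p.map (MvPolynomial.eval a))).eval z ≠ 0 := by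
    have := evalAt_zDeriv_ne_zero ha hz.1 le_rfl hd1
    rwa [evalAt_zDeriv] at this
  -- The sign change between `u` and `v` persists for nearby parameters and yields a root; `δ` keeps
  -- it where the derivative signs are constant.
  obtain ⟨u, v, hu, huv, hv, hneg⟩ :=
    exists_eval_mul_eval_neg (f := p.map (MvPolynomial.eval a)) hz.1 hz' (lt_min hε hδ)
  have hcont : Continuous fun b => evalAt p u b * evalAt p v b :=
    ((continuous_evalAt p).comp (Continuous.prodMk_right u)).mul
      ((continuous_evalAt p).comp (Continuous.prodMk_right v))
  filter_upwards [hQ, hcont.continuousAt.eventually (gt_mem_nhds hneg)] with b hb hbneg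
  have hcz : ContinuousOn (fun t => evalAt p t b) (Set.uIcc u v) :=
    ((continuous_evalAt p).comp (Continuous.prodMk_left b)).continuousOn
  have h0 : (0 : ℝ) ∈ Set.uIcc (evalAt p u b) (evalAt p v b) := by
    rcases mul_neg_iff.1 hbneg with h | h
    · exact Set.mem_uIcc.2 (Or.inr ⟨h.2.le, h.1.le⟩)
    · exact Set.mem_uIcc.2 (Or.inl ⟨h.1.le, h.2.le⟩)
  obtain ⟨w, hw, hw0⟩ := intermediate_value_uIcc hcz h0
  rw [Set.uIcc_of_le huv.le] at hw
  have hwz : |w - z| < min ε δ := abs_lt.2 ⟨by linarith [hw.1], by linarith [hw.2]⟩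
  refine ⟨w, hwz.trans_le (min_le_left _ _), hw0, fun i h1 hi => ?_⟩
  rw [← hz.2 i h1 hi]
  exact hPQ (@hball w (by rw [Real.dist_eq]; exact hwz.trans_le (min_le_right _ _))) hb i h1 hi

/-- The set of regular parameters at which there is a root with the signs `s` is open. -/
theorem isOpen_exists_isRootWithSigns (hd1 : 1 ≤ p.natDegree) (s : ℕ → SignType) :
    IsOpen {a | a ∈ regularSet p ∧ ∃ z, IsRootWithSigns p s z a} := by
  rw [isOpen_iff_mem_nhds]
  rintro a ⟨ha, z, hz⟩
  filter_upwards [(isOpen_regularSet p).mem_nhds ha, hz.eventually_exists hd1 ha one_pos]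
    with b hb ⟨w, _, hw⟩
  exact ⟨hb, w, hw⟩

/-- The set of regular parameters at which there is a root with the signs `s` is closed in the
regular set. -/
theorem exists_isRootWithSigns_of_mem_closure (hd1 : 1 ≤ p.natDegree) (s : ℕ → SignType)
    {a : Fin n → ℝ} (ha : a ∈ regularSet p)
    (hcl : a ∈ closure {a | a ∈ regularSet p ∧ ∃ z, IsRootWithSigns p s z a}) :
    ∃ z, IsRootWithSigns p s z a := by
  obtain ⟨b, hb, hlim⟩ := mem_closure_iff_seq_limit.1 hcl
  choose hbreg z hz using hb
  -- This root bound is continuous at `a`, hence bounds the roots along the sequence and gives a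
  -- convergent subsequence.
  set B : (Fin n → ℝ) → ℝ := fun c =>
    1 + (∑ i ∈ Finset.range p.natDegree, |MvPolynomial.eval c (p.coeff i)|) /
      |MvPolynomial.eval c (p.coeff p.natDegree)| with hB
  have hBcont : ContinuousAt B a := by
    refine continuousAt_const.add (ContinuousAt.div ?_ ?_ ?_)
    · exact (continuous_finsetSum _ fun i _ =>
        (MvPolynomial.continuous_eval (p.coeff i)).abs).continuousAt
    · exact (MvPolynomial.continuous_eval (p.coeff p.natDegree)).abs.continuousAt
    · exact abs_ne_zero.2 (eval_leadingCoeff_ne_zero hd1 ha)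
  have hev : ∀ᶠ k in Filter.atTop, z k ∈ Metric.closedBall (0 : ℝ) (B a + 1) := by
    filter_upwards [(hBcont.tendsto.comp hlim).eventually (gt_mem_nhds (lt_add_one (B a)))]
      with k hk
    rw [mem_closedBall_zero_iff, Real.norm_eq_abs]
    exact (abs_le_of_evalAt_eq_zero (eval_leadingCoeff_ne_zero hd1 (hbreg k)) (hz k).1).trans
      hk.le
  obtain ⟨w, -, φ, hφ, hw⟩ :=
    tendsto_subseq_of_frequently_bounded Metric.isBounded_closedBall hev.frequently
  have hpair : Filter.Tendsto (fun k => (z (φ k), b (φ k))) Filter.atTop (nhds (w, a)) :=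
    hw.prodMk_nhds (hlim.comp hφ.tendsto_atTop)
  have hw0 : evalAt p w a = 0 := by
    have h1 := ((continuous_evalAt p).tendsto (w, a)).comp hpair
    refine tendsto_nhds_unique h1 ?_
    refine tendsto_const_nhds.congr fun k => ?_
    exact (hz (φ k)).1.symm
  -- Since `a` is regular, no derivative vanishes at the limit root, so its signs are those of
  -- nearby terms.
  obtain ⟨k, hk⟩ := (hpair.eventually (eventually_sign_evalAt_zDeriv_eq ha hw0)).exists
  exact ⟨w, hw0, fun i h1 hi => by rw [← hk i h1 hi, (hz (φ k)).2 i h1 hi]⟩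

/-- Over a connected set of regular parameters, a combination of signs that occurs at a root
occurs everywhere. -/
theorem exists_isRootWithSigns_of_isPreconnected (hd1 : 1 ≤ p.natDegree)
    {C : Set (Fin n → ℝ)} (hC : IsPreconnected C) (hCreg : C ⊆ regularSet p)
    {s : ℕ → SignType} {a b : Fin n → ℝ} (ha : a ∈ C) (hb : b ∈ C) {z : ℝ}
    (hz : IsRootWithSigns p s z a) : ∃ w, IsRootWithSigns p s w b := by
  have hsub := hC.subset_of_closure_inter_subset (isOpen_exists_isRootWithSigns hd1 s)
    ⟨a, ha, hCreg ha, z, hz⟩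
    fun c hc => ⟨hCreg hc.2, exists_isRootWithSigns_of_mem_closure hd1 s (hCreg hc.2) hc.1⟩
  exact (hsub hb).2

/-- A function selecting the root with given signs is continuous. -/
theorem continuousOn_of_isRootWithSigns (hd1 : 1 ≤ p.natDegree)
    {C : Set (Fin n → ℝ)} (hCreg : C ⊆ regularSet p) {s : ℕ → SignType}
    {r : (Fin n → ℝ) → ℝ} (hr : ∀ a ∈ C, IsRootWithSigns p s (r a) a) : ContinuousOn r C := by
  intro a ha
  rw [ContinuousWithinAt, Metric.tendsto_nhds]
  intro ε hε
  filter_upwards [mem_nhdsWithin_of_mem_nhds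
    ((hr a ha).eventually_exists hd1 (hCreg ha) hε), self_mem_nhdsWithin] with b ⟨w, hw, hwb⟩ hb
  rw [Real.dist_eq, (hr b hb).unique hd1 (hCreg hb) hwb]
  exact hw

end Family

/-! ### Root functions over a component -/

theorem mainTheorem1 (n d : ℕ) (p : (MvPolynomial (Fin n) ℝ)[X])
    (hd : p.natDegree = d) (hd1 : 1 ≤ d) :
    IsOpen (regularSet p) ∧
    ∀ C : Set (Fin n → ℝ),
      (∃ a₀ ∈ regularSet p, C = connectedComponentIn (regularSet p) a₀) →
      ∃ (k : ℕ) (r : Fin k → (Fin n → ℝ) → ℝ),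
        ((∀ j, ContinuousOn (r j) C) ∧
          (∀ a ∈ C, StrictMono fun j => r j a) ∧
          (∀ a ∈ C, {z : ℝ | evalAt p z a = 0} = Set.range fun j => r j a)) ∧
        ∃ σ : ℕ → Fin k → SignType,
          (∀ i, 1 ≤ i → i ≤ d → ∀ j, σ i j ≠ 0 ∧
            ∀ a ∈ C, SignType.sign (evalAt (zDeriv p i) (r j a) a) = σ i j) ∧
          (∀ j, ∀ a ∈ C, ∀ z : ℝ, z = r j a ↔
            (evalAt p z a = 0 ∧ ∀ i, 1 ≤ i → i ≤ d →
              SignType.sign (evalAt (zDeriv p i) z a) = σ i j)) := by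
  subst hd
  refine ⟨isOpen_regularSet p, ?_⟩
  rintro C ⟨a₀, ha₀, rfl⟩
  set C := connectedComponentIn (regularSet p) a₀ with hCdef
  have hC : IsPreconnected C := isPreconnected_connectedComponentIn
  have hCreg : C ⊆ regularSet p := connectedComponentIn_subset _ _
  have haC : a₀ ∈ C := mem_connectedComponentIn ha₀
  have hp0 : p.map (MvPolynomial.eval a₀) ≠ 0 := fun h => by
    apply eval_leadingCoeff_ne_zero hd1 ha₀
    rw [← coeff_map, h, coeff_zero]
  set R : Finset ℝ := (p.map (MvPolynomial.eval a₀)).roots.toFinset with hR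
  have memR : ∀ z, z ∈ R ↔ evalAt p z a₀ = 0 := fun z => by
    rw [hR, Multiset.mem_toFinset, mem_roots hp0, IsRoot.def, evalAt]
  let e := R.orderEmbOfFin rfl
  have he : ∀ j, evalAt p (e j) a₀ = 0 := fun j => (memR _).1 (R.orderEmbOfFin_mem rfl j)
  let σ : ℕ → Fin R.card → SignType := fun i j => SignType.sign (evalAt (zDeriv p i) (e j) a₀)
  have heσ : ∀ j, IsRootWithSigns p (fun i => σ i j) (e j) a₀ := fun j =>
    ⟨he j, fun _ _ _ => rfl⟩
  -- Membership in `C` sits inside the existential so that `choose` gives functions on the whole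
  -- space; values off `C` are irrelevant.
  have hex : ∀ (j : Fin R.card) (a : Fin n → ℝ), ∃ z, a ∈ C →
      IsRootWithSigns p (fun i => σ i j) z a := by
    intro j a
    by_cases ha : a ∈ C
    · obtain ⟨z, hz⟩ := exists_isRootWithSigns_of_isPreconnected hd1 hC hCreg haC ha (heσ j)
      exact ⟨z, fun _ => hz⟩
    · exact ⟨0, fun h => absurd h ha⟩
  choose r hr using hex
  have hcont : ∀ j, ContinuousOn (r j) C := fun j =>
    continuousOn_of_isRootWithSigns hd1 hCreg (hr j)
  have hr₀ : ∀ j, r j a₀ = e j := fun j => (hr j a₀ haC).unique hd1 ha₀ (heσ j)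
  have hinj : ∀ i j, ∀ a ∈ C, r i a = r j a → i = j := by
    intro i j a ha hij
    -- A coincidence at `a` would give two roots at `a₀` the same sign vector.
    have hj : IsRootWithSigns p (fun l => σ l j) (e i) a₀ := by
      refine ⟨he i, fun l h1 hl => ?_⟩
      rw [← (hr j a ha).2 l h1 hl, ← hij, (hr i a ha).2 l h1 hl]
    exact e.injective (hj.unique hd1 ha₀ (heσ j))
  refine ⟨R.card, r, ⟨hcont, fun a ha i j hij => ?_, fun a ha => ?_⟩, σ,
    fun i h1 hi j => ⟨?_, fun a ha => (hr j a ha).2 i h1 hi⟩, fun j a ha z => ⟨?_, ?_⟩⟩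
  · by_contra hcon
    have hcon' : r j a ≤ r i a := not_lt.1 hcon
    have h₀ : r i a₀ ≤ r j a₀ := by
      rw [hr₀, hr₀]
      exact (e.strictMono hij).le
    -- A reversal of order would force two root functions to meet on the connected set `C`.
    obtain ⟨b, hb, hbij⟩ := hC.intermediate_value₂ haC ha (hcont i) (hcont j) h₀ hcon'
    exact hij.ne (hinj i j b hb hbij)
  · ext z
    constructor
    · intro hz
      have hz' : IsRootWithSigns p (fun i => SignType.sign (evalAt (zDeriv p i) z a)) z a :=
        ⟨hz, fun _ _ _ => rfl⟩
      -- Transport back to `a₀` shows that no sign vector outside `σ` occurs at `a`.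
      obtain ⟨w, hw⟩ := exists_isRootWithSigns_of_isPreconnected hd1 hC hCreg ha haC hz'
      have hwR : w ∈ Set.range e := by
        rw [Finset.range_orderEmbOfFin]
        exact (memR w).2 hw.1
      obtain ⟨j, rfl⟩ := hwR
      refine ⟨j, (hr j a ha).unique hd1 (hCreg ha) ⟨hz, fun i h1 hi => ?_⟩⟩
      exact (hw.2 i h1 hi).symm
    · rintro ⟨j, rfl⟩
      exact (hr j a ha).1
  · exact sign_ne_zero.2 (evalAt_zDeriv_ne_zero ha₀ (he j) h1 hi)
  · rintro rfl
    exact hr j a ha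
  · intro hz
    exact IsRootWithSigns.unique hd1 (hCreg ha) hz (hr j a ha)
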